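/- Let $f\in\mathbb R[x,y]$ and $\rho=x^2+y^2$, and assume that $f$ is primitive, i.e. $f\neq P\circ\rho$ for every real polynomial $P$ in one variable. Definitions. Let $M(f)=\{\mathrm{Jac}(f,\rho)=0\}\subset\mathbb R^2$ be the Milnor set of $f$, let $g$ be the product of the distinct (pairwise non-associate) irreducible factors of $\mathrm{Jac}(f,\rho)$ in $\mathbb R[x,y]$, let $\mu(M(f))=\{g=0,\ y g_x-x g_y=0\}$ (the points where $\rho$ is not transverse to the reduced curve $\{g=0\}$; this set is compact), and let $R_0\ge 0$ be the infimum of all $r>0$ such that $\mu(M(f))$ is contained in the open disk of radius $r$ centred at the origin. A Milnor arc at infinity is a connected component $\gamma$ of $M(f)\setminus\{\|p\|\le R_0\}$. For Milnor arcs $\gamma,\delta$, we say that $\delta$ is the consecutive of $\gamma$, and $\gamma$ the antecedent of $\delta$, if on every large enough circle $S$ centred at the origin, moving counterclockwise from the point $\gamma\cap S$ one arrives at the point $\delta\cap S$ without meeting another point of $M(f)$. A Milnor arc $\gamma$ is increasing to $\lambda\in\mathbb R$ if, for a parametrization $s\mapsto\gamma(s)$, $s\in\,]R_0,\infty[$,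 of $\gamma$ with $\lim_{s\to\infty}\|\gamma(s)\|=\infty$, the function $f(\gamma(s))$ is strictly increasing and $\lim_{s\to\infty}f(\gamma(s))=\lambda$. An increasing $\mu$-cluster at $\lambda$ is a finite nonempty sequence $\gamma_0,\dots,\gamma_n$ of Milnor arcs, each $\gamma_{i+1}$ being the consecutive of $\gamma_i$, which are all increasing to $\lambda$, while neither the antecedent of $\gamma_0$ nor the consecutive of $\gamma_n$ is increasing to $\lambda$. Proposition. Let $\lambda\in\mathbb R$ be a regular value of $f$ (i.e. $f^{-1}(\lambda)$ contains no critical point of $f$), and let $\mathcal C_1,\dots,\mathcal C_r$ be all the increasing $\mu$-clusters at $\lambda$. Then there exists $\eta^*>0$ such that for every $t\in\,]\lambda-\eta^*,\lambda[$ and every $i=1,\dots,r$ there is a unique connected component of $f^{-1}(t)$ that intersects all the Milnor arcs at infinity in $\mathcal C_i$. -/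

import Mathlib

open Filter Topology

namespace MilnorCluster

/-- The Euclidean plane `ℝ²`. -/
abbrev Plane := EuclideanSpace ℝ (Fin 2)

/-- Real polynomials in the two variables `x = X 0`, `y = X 1`. -/
abbrev Poly := MvPolynomial (Fin 2) ℝ

/-- The polynomial function `ℝ² → ℝ` defined by `f`. -/
noncomputable def value (f : Poly) (p : Plane) : ℝ := MvPolynomial.eval (fun i => p i) f

/-- The square of the Euclidean distance to the origin, `ρ = x² + y²`. -/
noncomputable def rho : Poly := MvPolynomial.X 0 ^ 2 + MvPolynomial.X 1 ^ 2

/-- The Jacobian determinant `f_x g_y - f_y g_x` of the map `(f, g)`. -/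
noncomputable def jac (f g : Poly) : Poly :=
  MvPolynomial.pderiv 0 f * MvPolynomial.pderiv 1 g -
    MvPolynomial.pderiv 1 f * MvPolynomial.pderiv 0 g

/-- `f` is primitive (relative to `ρ`): it is not of the form `P ∘ ρ` with `P` a real
polynomial in one variable. -/
def IsPrimitive (f : Poly) : Prop := ∀ P : Polynomial ℝ, f ≠ Polynomial.aeval rho P

/-- The set `Sing f` of critical points of `f`. -/
def singSet (f : Poly) : Set Plane := {p | ∀ i, value (MvPolynomial.pderiv i f) p = 0}

/-- `l` is a regular value of `f`: its fibre contains no critical point. -/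
def IsRegularValue (f : Poly) (l : ℝ) : Prop := ∀ p : Plane, value f p = l → p ∉ singSet f

/-- The Milnor set `M(f)`: the points where `ρ` and `f` are not transverse. -/
def milnorSet (f : Poly) : Set Plane := {p | value (jac f rho) p = 0}

/-- `g` is, up to a nonzero constant factor, the product of the distinct irreducible factors
of `h`: it has no multiple factors, and the same irreducible factors as `h`. -/
def IsReducedPart (g h : Poly) : Prop :=
  Squarefree g ∧ ∀ q : Poly, Irreducible q → (q ∣ g ↔ q ∣ h)

/-- The set `μ(M(f))` of the points where `ρ` is not transverse to the reduced curve
`M(f)_red = {g = 0}`, where `g` is the reduced part of `Jac(f, ρ)`; it is given by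
`g = 0` and `y g_x - x g_y = 0`. (The reduced part is unique up to a nonzero constant factor,
which does not affect these equations.) -/
def muSet (f : Poly) : Set Plane :=
  {p | ∃ g : Poly, IsReducedPart g (jac f rho) ∧
    value g p = 0 ∧
    p 1 * value (MvPolynomial.pderiv 0 g) p - p 0 * value (MvPolynomial.pderiv 1 g) p = 0}

/-- The Milnor radius at infinity `R₀`: the infimum of the radii of the open disks centred at
the origin that contain `μ(M(f))`. -/
noncomputable def milnorRadius (f : Poly) : ℝ :=
  sInf {r : ℝ | 0 < r ∧ muSet f ⊆ Metric.ball 0 r}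

/-- `K` is a connected component of the subspace `S`. -/
def IsComponentOf (K S : Set Plane) : Prop := ∃ p ∈ S, K = connectedComponentIn S p

/-- `γ` is a Milnor arc at infinity: a connected component of `M(f)` outside the closed disk of
radius `R₀`. -/
def IsMilnorArc (f : Poly) (γ : Set Plane) : Prop :=
  IsComponentOf γ (milnorSet f \ Metric.closedBall 0 (milnorRadius f))

/-- The counterclockwise rotation by the angle `θ` around the origin. -/
noncomputable def rot (θ : ℝ) (p : Plane) : Plane :=
  !₂[Real.cos θ * p 0 - Real.sin θ * p 1, Real.sin θ * p 0 + Real.cos θ * p 1]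

/-- Moving counterclockwise from `p` along the circle through `p` centred at the origin, one
arrives at `q` without meeting any point of `S` in between. -/
def IsConsecutivePoint (S : Set Plane) (p q : Plane) : Prop :=
  ∃ θ : ℝ, 0 < θ ∧ θ ≤ 2 * Real.pi ∧ q = rot θ p ∧ ∀ s ∈ Set.Ioo 0 θ, rot s p ∉ S

/-- The Milnor arc `δ` is the consecutive of `γ` (and `γ` the antecedent of `δ`): on every large
enough circle centred at the origin, the point of `δ` is the consecutive of the point of `γ`
among the points of `M(f)` on that circle. -/
def IsConsecutiveArc (f : Poly) (γ δ : Set Plane) : Prop :=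
  IsMilnorArc f γ ∧ IsMilnorArc f δ ∧
    ∀ᶠ R : ℝ in atTop, ∃ p q : Plane,
      γ ∩ Metric.sphere 0 R = {p} ∧ δ ∩ Metric.sphere 0 R = {q} ∧
        IsConsecutivePoint (milnorSet f) p q

/-- `c` restricts to a parametrization `]R, ∞[ → γ` of `γ` with `‖c s‖ → ∞` as `s → ∞`. -/
def IsParametrization (R : ℝ) (γ : Set Plane) (c : ℝ → Plane) : Prop :=
  ContinuousOn c (Set.Ioi R) ∧ Set.InjOn c (Set.Ioi R) ∧ c '' Set.Ioi R = γ ∧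
    Tendsto (fun s => ‖c s‖) atTop atTop

/-- `γ` is a Milnor arc at infinity which is increasing to `l`: along a parametrization of `γ`
towards infinity, `f` is strictly increasing and tends to `l`. -/
def IsIncreasingTo (f : Poly) (γ : Set Plane) (l : ℝ) : Prop :=
  IsMilnorArc f γ ∧ ∃ c : ℝ → Plane, IsParametrization (milnorRadius f) γ c ∧
    StrictMonoOn (fun s => value f (c s)) (Set.Ioi (milnorRadius f)) ∧
    Tendsto (fun s => value f (c s)) atTop (𝓝 l)

/-- The sequence `C 0, …, C n` is an increasing `μ`-cluster at `l`: consecutive Milnor arcs at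
infinity, all increasing to `l`, such that neither the antecedent of the first one nor the
consecutive of the last one is increasing to `l`. -/
structure IsIncreasingCluster (f : Poly) (l : ℝ) {n : ℕ} (C : Fin (n + 1) → Set Plane) :
    Prop where
  consecutive : ∀ i : Fin n, IsConsecutiveArc f (C i.castSucc) (C i.succ)
  increasing : ∀ i, IsIncreasingTo f (C i) l
  antecedent_not : ∀ γ, IsConsecutiveArc f γ (C 0) → ¬ IsIncreasingTo f γ l
  consecutive_not : ∀ γ, IsConsecutiveArc f (C (Fin.last n)) γ → ¬ IsIncreasingTo f γ l

end MilnorCluster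

/-!
Uniqueness of the component is immediate: `f` is strictly increasing along an arc `γ` increasing to
`l`, so a fibre meets `γ` in at most one point (`IsIncreasingTo.eq_of_value_eq`), and in exactly one
when the level is slightly below `l`. It remains to see that, for two consecutive arcs `γ` and `δ`
increasing to `l`, the points of `γ` and of `δ` at a level `t` close to `l` lie in the same component
of the fibre.

The Jacobian of `f` and `ρ` is a multiple of the derivative of `f` along rotations
(`hasDerivAt_value_rot`). On a large circle the open circular arc from `γ` to `δ` avoids `M(f)`, so
`f` is injective on the closed arc by Rolle's theorem (`injOn_value_rot`). Moreover, as a large circle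
meets `γ` once, `f` restricted to `γ` is strictly increasing in the radius
(`IsIncreasingTo.strictMonoOn_radial`), and likewise on `δ`. Let `γ` and `δ` reach the level `t` at
the radii `r` and `r'`. On every circle of radius between `r` and `r'`, the value of `f` is at least
`t` at the end of the circular arc on the curve that has already reached the level, and at most `t`
at the other end; hence `t` is attained exactly once on the circular arc. By compactness this point
depends continuously on the radius, so the level `t` joins `γ` to `δ`
(`connectedComponentIn_eq_of_band`, `IsConsecutiveArc.eventually_connectedComponentIn_eq`).

The bound `η` can be taken uniform because only finitely many arcs increase to `l`
(`finite_setOf_isIncreasingTo`). Primitivity gives `Jac(f, ρ) ≠ 0`, and a nonzero polynomial has a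
bounded number of zeros on arbitrarily large circles (`exists_frequently_card_zeros_le`), while the
arcs in question are pairwise disjoint and each meets every large circle.
-/

namespace MilnorCluster

open Set

/-! ### Sections with compact graph and level curves of bands -/

/-- An injective continuous map on a compact set has a continuous inverse. -/
theorem continuousOn_section_of_isCompact {X Y : Type*} [TopologicalSpace X] [TopologicalSpace Y]
    [T2Space Y] {K : Set X} {φ : X → Y} {g : Y → X} {I : Set Y} (hK : IsCompact K)
    (hφ : ContinuousOn φ K) (hinj : InjOn φ K) (hg : ∀ y ∈ I, g y ∈ K ∧ φ (g y) = y) :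
    ContinuousOn g I := by
  rw [continuousOn_iff_isClosed]
  intro t ht
  refine ⟨φ '' (K ∩ t), ((hK.inter_right ht).image_of_continuousOn
    (hφ.mono inter_subset_left)).isClosed, ?_⟩
  ext y
  constructor
  · rintro ⟨hy, hyI⟩
    exact ⟨⟨g y, ⟨(hg y hyI).1, hy⟩, (hg y hyI).2⟩, hyI⟩
  · rintro ⟨⟨x, ⟨hxK, hxt⟩, hxy⟩, hyI⟩
    have : x = g y := hinj hxK (hg y hyI).1 (hxy.trans (hg y hyI).2.symm)
    exact ⟨show g y ∈ t from this ▸ hxt, hyI⟩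

/-- If `f` is injective on each fibre `{r} × [0, 1]` of a band and takes the value `t` there, then
the level `t` is, in the band, the graph of a continuous function of `r`, so its points over the
two ends of the band lie in one component of the fibre of `f`. -/
theorem connectedComponentIn_eq_of_band {X : Type*} [TopologicalSpace X] {G : ℝ × ℝ → X}
    {f : X → ℝ} {a b t u v : ℝ} (hab : a ≤ b) (hf : Continuous f)
    (hG : ContinuousOn G (Icc a b ×ˢ Icc 0 1))
    (hinj : ∀ r ∈ Icc a b, InjOn (fun u => f (G (r, u))) (Icc 0 1))
    (ht : ∀ r ∈ Icc a b, t ∈ uIcc (f (G (r, 0))) (f (G (r, 1))))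
    (hu : u ∈ Icc (0 : ℝ) 1) (hv : v ∈ Icc (0 : ℝ) 1)
    (hau : f (G (a, u)) = t) (hbv : f (G (b, v)) = t) :
    connectedComponentIn {x | f x = t} (G (a, u)) =
      connectedComponentIn {x | f x = t} (G (b, v)) := by
  have hlevel : ∀ r, ∃ w, r ∈ Icc a b → w ∈ Icc (0 : ℝ) 1 ∧ f (G (r, w)) = t := by
    intro r
    by_cases hr : r ∈ Icc a b
    · have hc : ContinuousOn (fun w => f (G (r, w))) (uIcc 0 1) := by
        rw [uIcc_of_le zero_le_one]
        exact hf.comp_continuousOn (hG.comp (by fun_prop) fun w hw => ⟨hr, hw⟩)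
      obtain ⟨w, hw, hwt⟩ := intermediate_value_uIcc hc (ht r hr)
      rw [uIcc_of_le zero_le_one] at hw
      exact ⟨w, fun _ => ⟨hw, hwt⟩⟩
    · exact ⟨0, fun h => absurd h hr⟩
  choose w hw using hlevel
  set E : Set (ℝ × ℝ) := {z ∈ Icc a b ×ˢ Icc 0 1 | f (G z) = t}
  have hE : IsCompact E := by
    refine (isCompact_Icc.prod isCompact_Icc).of_isClosed_subset ?_ (sep_subset _ _)
    exact (hf.comp_continuousOn hG).preimage_isClosed_of_isClosed
      (isClosed_Icc.prod isClosed_Icc) isClosed_singleton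
  have hc : ContinuousOn (fun r => (r, w r)) (Icc a b) := by
    refine continuousOn_section_of_isCompact hE continuous_fst.continuousOn ?_
      fun r hr => ⟨⟨⟨hr, (hw r hr).1⟩, (hw r hr).2⟩, rfl⟩
    rintro ⟨r, u₁⟩ ⟨⟨hr, h₁⟩, e₁⟩ ⟨r', u₂⟩ ⟨⟨-, h₂⟩, e₂⟩ (rfl : r = r')
    exact Prod.ext rfl (hinj r hr h₁ h₂ (e₁.trans e₂.symm))
  have hpre : IsPreconnected ((fun r => G (r, w r)) '' Icc a b) :=
    isPreconnected_Icc.image _ (hG.comp hc fun r hr => ⟨hr, (hw r hr).1⟩)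
  have ha := left_mem_Icc.2 hab
  have hb := right_mem_Icc.2 hab
  have hwa : w a = u := hinj a ha (hw a ha).1 hu ((hw a ha).2.trans hau.symm)
  have hwb : w b = v := hinj b hb (hw b hb).1 hv ((hw b hb).2.trans hbv.symm)
  refine connectedComponentIn_eq (hpre.subset_connectedComponentIn ⟨a, ha, by rw [← hwa]⟩ ?_
    ⟨b, hb, by rw [← hwb]⟩)
  rintro _ ⟨r, hr, rfl⟩
  exact (hw r hr).2

/-! ### Rotations and the Jacobian with `ρ` -/

theorem continuous_value (f : Poly) : Continuous (value f) := by
  unfold value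
  exact MvPolynomial.continuous_eval f |>.comp (by fun_prop)

theorem continuous_rot : Continuous fun z : ℝ × Plane => rot z.1 z.2 := by
  unfold rot
  refine (PiLp.continuous_toLp 2 _).comp (continuous_pi fun i => ?_)
  fin_cases i <;> simp <;> fun_prop

@[simp] theorem rot_apply_zero (θ : ℝ) (p : Plane) :
    rot θ p 0 = Real.cos θ * p 0 - Real.sin θ * p 1 := by simp [rot]

@[simp] theorem rot_apply_one (θ : ℝ) (p : Plane) :
    rot θ p 1 = Real.sin θ * p 0 + Real.cos θ * p 1 := by simp [rot]

theorem plane_ext {p q : Plane} (h0 : p 0 = q 0) (h1 : p 1 = q 1) : p = q := by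
  ext i; fin_cases i <;> assumption

@[simp] theorem rot_zero (p : Plane) : rot 0 p = p := by
  apply plane_ext <;> simp

theorem rot_two_pi (p : Plane) : rot (2 * Real.pi) p = p := by
  apply plane_ext <;> simp

theorem norm_sq_eq (p : Plane) : ‖p‖ ^ 2 = p 0 ^ 2 + p 1 ^ 2 := by
  simp [EuclideanSpace.norm_sq_eq, Fin.sum_univ_two]

theorem eq_of_rot_eq_rot {p : Plane} (hp : p ≠ 0) {α β : ℝ} (hα : α ∈ Ioo 0 (2 * Real.pi))
    (hβ : β ∈ Ioo 0 (2 * Real.pi)) (h : rot α p = rot β p) : α = β := by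
  have h0 : rot α p 0 = rot β p 0 := by rw [h]
  have h1 : rot α p 1 = rot β p 1 := by rw [h]
  simp only [rot_apply_zero, rot_apply_one] at h0 h1
  have hn : p 0 ^ 2 + p 1 ^ 2 ≠ 0 := by
    rw [← norm_sq_eq]; exact pow_ne_zero 2 (norm_ne_zero_iff.2 hp)
  have hc : Real.cos α = Real.cos β :=
    mul_right_cancel₀ hn (by linear_combination p 0 * h0 + p 1 * h1)
  have hs : Real.sin α = Real.sin β :=
    mul_right_cancel₀ hn (by linear_combination p 0 * h1 - p 1 * h0)
  have : Real.cos (α - β) = 1 := by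
    rw [Real.cos_sub, hc, hs, ← sq, ← sq, Real.cos_sq_add_sin_sq]
  have := (Real.cos_eq_one_iff_of_lt_of_lt (by linarith [hα.1, hβ.2])
    (by linarith [hα.2, hβ.1])).1 this
  linarith

/-- The chain rule for a bivariate polynomial along a curve. -/
theorem hasDerivAt_eval (f : Poly) {x : Fin 2 → ℝ → ℝ} {x' : Fin 2 → ℝ} {s : ℝ}
    (hx : ∀ i, HasDerivAt (x i) (x' i) s) :
    HasDerivAt (fun s => MvPolynomial.eval (fun i => x i s) f)
      (∑ i, MvPolynomial.eval (fun i => x i s) (MvPolynomial.pderiv i f) * x' i) s := by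
  induction f using MvPolynomial.induction_on with
  | C a => simpa using hasDerivAt_const s a
  | add p q hp hq =>
    simp only [map_add, add_mul, Finset.sum_add_distrib]
    exact hp.add hq
  | mul_X p i hp =>
    have := hp.mul (hx i)
    simp only [map_mul, MvPolynomial.eval_X]
    refine this.congr_deriv ?_
    fin_cases i <;> simp [Fin.sum_univ_two, MvPolynomial.pderiv_X, Pi.single_apply] <;> ring

/-- Up to the factor `-1/2`, the function `Jac(f, ρ)` is the angular derivative of `f`. -/
theorem hasDerivAt_value_rot (f : Poly) (p : Plane) (s : ℝ) :
    HasDerivAt (fun s => value f (rot s p)) (-(1 / 2) * value (jac f rho) (rot s p)) s := by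
  have h0 : HasDerivAt (fun s => rot s p 0) (-(rot s p 1)) s := by
    simp only [rot_apply_zero, rot_apply_one]
    exact (((Real.hasDerivAt_cos s).mul_const (p 0)).sub
      ((Real.hasDerivAt_sin s).mul_const (p 1))).congr_deriv (by ring)
  have h1 : HasDerivAt (fun s => rot s p 1) (rot s p 0) s := by
    simp only [rot_apply_zero, rot_apply_one]
    exact (((Real.hasDerivAt_sin s).mul_const (p 0)).add
      ((Real.hasDerivAt_cos s).mul_const (p 1))).congr_deriv (by ring)
  have := hasDerivAt_eval f (x := fun i s => rot s p i) (x' := ![-(rot s p 1), rot s p 0])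
    (s := s) (fun i => by fin_cases i <;> assumption)
  refine this.congr_deriv ?_
  simp [Fin.sum_univ_two, value, jac, rho, MvPolynomial.pderiv_X]
  ring

theorem exists_eq_rot (p : Plane) : ∃ θ, p = rot θ !₂[‖p‖, 0] := by
  have hn : ‖(⟨p 0, p 1⟩ : ℂ)‖ = ‖p‖ := by
    rw [← sq_eq_sq₀ (norm_nonneg _) (norm_nonneg _), norm_sq_eq, ← Complex.normSq_eq_norm_sq,
      Complex.normSq_mk]
    ring
  refine ⟨Complex.arg ⟨p 0, p 1⟩, plane_ext ?_ ?_⟩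
  · have := Complex.norm_mul_cos_arg ⟨p 0, p 1⟩
    rw [hn] at this
    simp only [rot_apply_zero]
    simp; linarith
  · have := Complex.norm_mul_sin_arg ⟨p 0, p 1⟩
    rw [hn] at this
    simp only [rot_apply_one]
    simp; linarith

/-- An even polynomial is a polynomial in the square of the variable. -/
theorem exists_eq_expand_of_even {p : Polynomial ℝ} (hp : ∀ x, p.eval (-x) = p.eval x) :
    ∃ P : Polynomial ℝ, ∀ x, p.eval x = P.eval (x ^ 2) := by
  have hcomp : p.comp (-Polynomial.X) = p := Polynomial.funext fun x => by simpa using hp x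
  refine ⟨p.contract 2, fun x => ?_⟩
  have : Polynomial.expand ℝ 2 (p.contract 2) = p := by
    ext n
    rw [Polynomial.coeff_expand two_pos, Polynomial.coeff_contract two_ne_zero]
    split_ifs with h
    · rw [Nat.div_mul_cancel h]
    · have hn : p.coeff n = -p.coeff n := by
        conv_lhs => rw [← hcomp, ← neg_one_mul (Polynomial.X : Polynomial ℝ), ← Polynomial.C_1,
          ← Polynomial.C_neg, Polynomial.comp_C_mul_X_coeff]
        rw [Odd.neg_one_pow (by rwa [← Nat.not_even_iff_odd, even_iff_two_dvd])]
        ring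
      linarith
  conv_lhs => rw [← this]
  rw [Polynomial.expand_eval]

/-- If `Jac(f, ρ)` vanishes identically then `f` is constant on every circle centred at the
origin, so it is the polynomial in `ρ` read off from the even polynomial `f(x, 0)`. -/
theorem IsPrimitive.jac_rho_ne_zero {f : Poly} (hf : IsPrimitive f) : jac f rho ≠ 0 := by
  intro hj
  have hrot : ∀ p s, value f (rot s p) = value f p := by
    intro p s
    have hd : ∀ s, HasDerivAt (fun s => value f (rot s p)) 0 s := fun s => by
      simpa [hj, value] using hasDerivAt_value_rot f p s
    have := is_const_of_deriv_eq_zero (fun s => (hd s).differentiableAt)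
      (fun s => (hd s).deriv) s 0
    simpa using this
  let p : Polynomial ℝ := MvPolynomial.aeval ![Polynomial.X, 0] f
  have hp : ∀ x : ℝ, p.eval x = value f !₂[x, 0] := by
    intro x
    change Polynomial.evalRingHom x (MvPolynomial.aeval ![Polynomial.X, 0] f) = _
    rw [MvPolynomial.aeval_def, MvPolynomial.eval₂_eq', value, MvPolynomial.eval_eq']
    simp [Fin.prod_univ_two]
  obtain ⟨P, hP⟩ := exists_eq_expand_of_even (p := p) fun x => by
    rw [hp, hp, ← hrot !₂[x, 0] Real.pi]
    congr 1
    apply plane_ext <;> simp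
  refine hf P (MvPolynomial.funext fun z => ?_)
  have hz : MvPolynomial.eval z f = value f (!₂[z 0, z 1]) := by
    unfold value
    congr 2
    ext i; fin_cases i <;> simp
  obtain ⟨θ, hθ⟩ := exists_eq_rot !₂[z 0, z 1]
  rw [hz, hθ, hrot, ← hp, hP, norm_sq_eq]
  rw [← MvPolynomial.coe_aeval_eq_eval, RingHom.coe_coe, ← Polynomial.aeval_algHom_apply]
  simp [rho, Polynomial.aeval_def, Polynomial.eval₂_eq_eval_map]

/-! ### Zeros of a polynomial on circles -/

open Polynomial in
/-- The pullback of `h` along the rational parametrization of the circle of radius `R`, cleared of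
denominators. The exponent `d`, hence the bound on the degree, does not depend on `R`. -/
theorem exists_circle_polynomial (h : Poly) : ∃ d : ℕ, ∀ R : ℝ, ∃ Q : ℝ[X], Q.natDegree ≤ 2 * d ∧
    ∀ s : ℝ, Q.eval s = (1 + s ^ 2) ^ d *
      value h !₂[R * (1 - s ^ 2) / (1 + s ^ 2), R * (2 * s) / (1 + s ^ 2)] := by
  have hpow : ∀ d : ℕ, ((1 + X ^ 2 : ℝ[X]) ^ d).natDegree ≤ 2 * d := fun d => by
    refine natDegree_pow_le.trans ?_
    rw [mul_comm]
    exact Nat.mul_le_mul_right d (by compute_degree)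
  induction h using MvPolynomial.induction_on with
  | C a => exact ⟨0, fun R => ⟨C a, by simp, fun s => by simp [value]⟩⟩
  | add p q hp hq =>
    obtain ⟨d, hp⟩ := hp
    obtain ⟨e, hq⟩ := hq
    refine ⟨d + e, fun R => ?_⟩
    obtain ⟨P, hPd, hP⟩ := hp R
    obtain ⟨Q, hQd, hQ⟩ := hq R
    refine ⟨P * (1 + X ^ 2) ^ e + Q * (1 + X ^ 2) ^ d, ?_, fun s => ?_⟩
    · refine natDegree_add_le_of_degree_le (natDegree_mul_le.trans ?_) (natDegree_mul_le.trans ?_)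
      · linarith [hpow e]
      · linarith [hpow d]
    · simp only [value, map_add] at hP hQ ⊢
      simp only [eval_add, eval_mul, eval_pow, eval_one, eval_X, hP, hQ]
      ring
  | mul_X p i hp =>
    obtain ⟨d, hp⟩ := hp
    refine ⟨d + 1, fun R => ?_⟩
    obtain ⟨P, hPd, hP⟩ := hp R
    refine ⟨P * ![C R * (1 - X ^ 2), C R * (2 * X)] i, ?_, fun s => ?_⟩
    · have : (![C R * (1 - X ^ 2), C R * (2 * X)] i : ℝ[X]).natDegree ≤ 2 := by
        fin_cases i <;> simp only [Fin.zero_eta, Fin.mk_one, Matrix.cons_val_zero,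
          Matrix.cons_val_one] <;> compute_degree!
      refine natDegree_mul_le.trans ?_
      linarith
    · have hs : (1 + s ^ 2) ≠ 0 := by positivity
      simp only [value, map_mul, MvPolynomial.eval_X] at hP ⊢
      rw [eval_mul, hP]
      fin_cases i <;> simp <;> field_simp <;> ring

/-- A polynomial with more zeros on a circle than a bound independent of the circle vanishes on the
right half of that circle. -/
theorem exists_card_zeros_le (h : Poly) : ∃ N : ℕ, ∀ R : ℝ, 0 < R → ∀ T : Finset Plane,
    (∀ p ∈ T, ‖p‖ = R ∧ value h p = 0) → N < T.card →
      ∀ p : Plane, ‖p‖ = R → 0 < p 0 → value h p = 0 := by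
  classical
  obtain ⟨d, hd⟩ := exists_circle_polynomial h
  refine ⟨2 * d + 1, fun R hR T hT hcard p hp hp0 => ?_⟩
  obtain ⟨Q, hQd, hQ⟩ := hd R
  have hnorm : ∀ q : Plane, ‖q‖ = R → q 0 ^ 2 + q 1 ^ 2 = R ^ 2 := fun q hq => by
    rw [← norm_sq_eq, hq]
  -- the point of the circle omitted by the parametrization
  have hpos : ∀ q : Plane, ‖q‖ = R → q ≠ !₂[-R, 0] → R + q 0 ≠ 0 := by
    intro q hq hne h0
    refine hne (plane_ext (by simp; linarith) ?_)
    have := hnorm q hq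
    rw [show q 0 = -R by linarith] at this
    simpa using this
  have hparam : ∀ q : Plane, ‖q‖ = R → R + q 0 ≠ 0 →
      !₂[R * (1 - (q 1 / (R + q 0)) ^ 2) / (1 + (q 1 / (R + q 0)) ^ 2),
        R * (2 * (q 1 / (R + q 0))) / (1 + (q 1 / (R + q 0)) ^ 2)] = q := by
    intro q hq h0
    have hn := hnorm q hq
    have hden : 1 + (q 1 / (R + q 0)) ^ 2 = 2 * R / (R + q 0) := by
      field_simp
      linear_combination hn
    have hnum : 1 - (q 1 / (R + q 0)) ^ 2 = 2 * q 0 / (R + q 0) := by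
      field_simp
      linear_combination -hn
    rw [hden, hnum]
    apply plane_ext <;> simp <;> field_simp
  have hQ0 : Q = 0 := by
    by_contra hne
    have hmaps : ∀ q ∈ T.erase !₂[-R, 0], q 1 / (R + q 0) ∈ Q.roots.toFinset := by
      intro q hq
      obtain ⟨hq1, hqT⟩ := Finset.mem_erase.1 hq
      obtain ⟨hqR, hq0⟩ := hT q hqT
      rw [Multiset.mem_toFinset, Polynomial.mem_roots hne, Polynomial.IsRoot, hQ,
        hparam q hqR (hpos q hqR hq1), hq0, mul_zero]
    have hinj : Set.InjOn (fun q : Plane => q 1 / (R + q 0)) (T.erase !₂[-R, 0]) := by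
      intro q hq q' hq' heq
      obtain ⟨hq1, hqT⟩ := Finset.mem_erase.1 hq
      obtain ⟨hq1', hqT'⟩ := Finset.mem_erase.1 hq'
      dsimp only at heq
      rw [← hparam q (hT q hqT).1 (hpos q (hT q hqT).1 hq1), heq,
        hparam q' (hT q' hqT').1 (hpos q' (hT q' hqT').1 hq1')]
    have h1 := Finset.card_le_card_of_injOn _ hmaps hinj
    have h2 := Multiset.toFinset_card_le Q.roots
    have h3 := Q.card_roots'
    have h4 := T.pred_card_le_card_erase (a := !₂[-R, 0])
    omega
  have h0 : R + p 0 ≠ 0 := by positivity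
  have := hQ (p 1 / (R + p 0))
  rw [hparam p hp h0, hQ0, Polynomial.eval_zero] at this
  exact (mul_eq_zero.1 this.symm).resolve_left (by positivity)

/-- A nonzero polynomial has a bounded number of zeros on arbitrarily large circles. -/
theorem exists_frequently_card_zeros_le {h : Poly} (hh : h ≠ 0) : ∃ N : ℕ, ∃ᶠ R : ℝ in atTop,
    ∀ T : Finset Plane, (∀ p ∈ T, ‖p‖ = R ∧ value h p = 0) → T.card ≤ N := by
  obtain ⟨N, hN⟩ := exists_card_zeros_le h
  refine ⟨N, fun hev => hh ?_⟩
  obtain ⟨r, hr⟩ := eventually_atTop.1 (hev.and (eventually_gt_atTop 0))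
  have hr0 : 0 < r := (hr r le_rfl).2
  refine MvPolynomial.funext_set (fun _ => Ioi r) (fun _ => Ioi_infinite r) fun x hx => ?_
  have hx0 : r < x 0 := hx 0 trivial
  have hxn : r ≤ ‖(!₂[x 0, x 1] : Plane)‖ := by
    refine le_of_sq_le_sq ?_ (norm_nonneg _)
    rw [norm_sq_eq]
    simp
    nlinarith [sq_nonneg (x 1)]
  have hR := hr _ hxn
  simp only [not_forall, not_le] at hR
  obtain ⟨⟨T, hT, hcard⟩, hpos⟩ := hR
  have := hN _ hpos T hT hcard _ rfl (by simpa using hr0.trans hx0)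
  rw [map_zero, ← this, value]
  congr 2
  ext i; fin_cases i <;> simp

/-! ### Milnor arcs -/

theorem isClosed_milnorSet (f : Poly) : IsClosed (milnorSet f) :=
  isClosed_singleton.preimage (continuous_value _)

theorem milnorRadius_nonneg (f : Poly) : 0 ≤ milnorRadius f :=
  Real.sInf_nonneg fun _ hr => hr.1.le

namespace IsMilnorArc

variable {f : Poly} {γ δ : Set Plane}

theorem subset (h : IsMilnorArc f γ) : γ ⊆ milnorSet f \ Metric.closedBall 0 (milnorRadius f) := by
  obtain ⟨p, -, rfl⟩ := h
  exact connectedComponentIn_subset _ _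

theorem isPreconnected (h : IsMilnorArc f γ) : IsPreconnected γ := by
  obtain ⟨p, -, rfl⟩ := h
  exact isPreconnected_connectedComponentIn

theorem eq_of_mem (hγ : IsMilnorArc f γ) (hδ : IsMilnorArc f δ) {x : Plane} (hxγ : x ∈ γ)
    (hxδ : x ∈ δ) : γ = δ := by
  obtain ⟨p, -, rfl⟩ := hγ
  obtain ⟨q, -, rfl⟩ := hδ
  rw [connectedComponentIn_eq hxγ, connectedComponentIn_eq hxδ]

/-- A Milnor arc is closed in the complement of the disk of radius `R₀`. -/
theorem isCompact_inter_annulus (h : IsMilnorArc f γ) {a : ℝ} (ha : milnorRadius f < a) (b : ℝ) :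
    IsCompact (γ ∩ {x | ‖x‖ ∈ Icc a b}) := by
  obtain ⟨p, hp, rfl⟩ := h
  set S := milnorSet f \ Metric.closedBall 0 (milnorRadius f)
  have hann : IsClosed {x : Plane | ‖x‖ ∈ Icc a b} := isClosed_Icc.preimage continuous_norm
  have hcl : closure (connectedComponentIn S p) ∩ S ⊆ connectedComponentIn S p :=
    (isPreconnected_connectedComponentIn.subset_closure
      (subset_inter subset_closure (connectedComponentIn_subset S p))
      inter_subset_left).subset_connectedComponentIn
      ⟨subset_closure (mem_connectedComponentIn hp), hp⟩ inter_subset_right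
  have heq : connectedComponentIn S p ∩ {x | ‖x‖ ∈ Icc a b} =
      closure (connectedComponentIn S p) ∩ {x | ‖x‖ ∈ Icc a b} := by
    refine subset_antisymm (inter_subset_inter_left _ subset_closure) fun x ⟨hx, hxa⟩ => ⟨?_, hxa⟩
    refine hcl ⟨hx, ?_, ?_⟩
    · exact closure_minimal ((connectedComponentIn_subset S p).trans sdiff_subset)
        (isClosed_milnorSet f) hx
    · simpa using ha.trans_le hxa.1
  rw [heq]
  refine (isCompact_closedBall (0 : Plane) b).of_isClosed_subset (isClosed_closure.inter hann) ?_
  exact fun x hx => by simpa using hx.2.2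

end IsMilnorArc

/-- The radial parametrization of a Milnor arc, by the distance to the origin, is continuous. -/
theorem IsMilnorArc.continuousOn_radial {f : Poly} {γ : Set Plane} (h : IsMilnorArc f γ) {a : ℝ}
    (ha : milnorRadius f < a) {p : ℝ → Plane}
    (hp : ∀ R, a ≤ R → γ ∩ Metric.sphere 0 R = {p R}) (b : ℝ) : ContinuousOn p (Icc a b) := by
  have hmem : ∀ R, a ≤ R → p R ∈ γ ∧ ‖p R‖ = R := fun R hR => by
    have : p R ∈ γ ∩ Metric.sphere 0 R := by rw [hp R hR]; rfl
    simpa using this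
  refine continuousOn_section_of_isCompact (h.isCompact_inter_annulus ha b)
    continuous_norm.continuousOn ?_ fun R hR => ?_
  · rintro x ⟨hx, hxa⟩ y ⟨hy, -⟩ hxy
    have hx' : x ∈ γ ∩ Metric.sphere 0 ‖x‖ := ⟨hx, by simp⟩
    have hy' : y ∈ γ ∩ Metric.sphere 0 ‖x‖ := ⟨hy, by simpa using hxy.symm⟩
    rw [hp _ hxa.1] at hx' hy'
    exact hx'.trans hy'.symm
  · obtain ⟨h1, h2⟩ := hmem R hR.1
    exact ⟨⟨h1, by simpa [h2] using hR⟩, h2⟩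

namespace IsIncreasingTo

variable {f : Poly} {γ δ : Set Plane} {l : ℝ}

theorem eq_of_value_eq (h : IsIncreasingTo f γ l) {x y : Plane} (hx : x ∈ γ) (hy : y ∈ γ)
    (hxy : value f x = value f y) : x = y := by
  obtain ⟨-, c, ⟨-, -, hc, -⟩, hmono, -⟩ := h
  rw [← hc] at hx hy
  obtain ⟨s, hs, rfl⟩ := hx
  obtain ⟨s', hs', rfl⟩ := hy
  rw [hmono.injOn hs hs' hxy]

/-- An arc increasing to `l` meets all levels slightly below `l`. -/
theorem eventually_exists_value_eq (h : IsIncreasingTo f γ l) :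
    ∀ᶠ t in 𝓝[<] l, ∃ x ∈ γ, value f x = t := by
  obtain ⟨-, c, ⟨hcont, -, hc, -⟩, hmono, hlim⟩ := h
  set R₀ := milnorRadius f
  have hs₀ : R₀ + 1 ∈ Ioi R₀ := lt_add_one R₀
  have hlt : value f (c (R₀ + 1)) < l := by
    have h1 : value f (c (R₀ + 1)) < value f (c (R₀ + 2)) :=
      hmono hs₀ (mem_Ioi.2 (by linarith)) (by linarith)
    refine h1.trans_le (ge_of_tendsto hlim ?_)
    filter_upwards [eventually_ge_atTop (R₀ + 2)] with s hs
    exact hmono.monotoneOn (mem_Ioi.2 (by linarith)) (mem_Ioi.2 (by linarith)) hs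
  filter_upwards [Ioo_mem_nhdsLT hlt] with t ht
  obtain ⟨s, hst, hs⟩ := ((hlim.eventually (eventually_gt_nhds ht.2)).and
    (eventually_gt_atTop R₀)).exists
  have hpre : IsPreconnected ((fun s => value f (c s)) '' Ioi R₀) :=
    isPreconnected_Ioi.image _ ((continuous_value f).comp_continuousOn hcont)
  obtain ⟨s', hs', hts'⟩ := hpre.Icc_subset (mem_image_of_mem _ hs₀) (mem_image_of_mem _ hs)
    ⟨ht.1.le, hst.le⟩
  exact ⟨c s', hc ▸ mem_image_of_mem c hs', hts'⟩

/-- An arc increasing to `l` is unbounded and connected, so it meets every large circle. -/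
theorem eventually_exists_norm_eq (h : IsIncreasingTo f γ l) :
    ∀ᶠ R in atTop, ∃ x ∈ γ, ‖x‖ = R := by
  obtain ⟨harc, c, ⟨-, -, hc, hlim⟩, -⟩ := h
  have hmem : ∀ᶠ s in atTop, c s ∈ γ := by
    filter_upwards [eventually_gt_atTop (milnorRadius f)] with s hs
    exact hc ▸ mem_image_of_mem c hs
  obtain ⟨s₀, hs₀⟩ := hmem.exists
  filter_upwards [eventually_ge_atTop ‖c s₀‖] with R hR
  obtain ⟨s, hs, hsR⟩ := (hmem.and (hlim.eventually_ge_atTop R)).exists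
  obtain ⟨x, hx, hxR⟩ := (harc.isPreconnected.image _ continuous_norm.continuousOn).Icc_subset
    (mem_image_of_mem _ hs₀) (mem_image_of_mem _ hs) ⟨hR, hsR⟩
  exact ⟨x, hx, hxR⟩

/-- On an arc that meets large circles once, `f` is strictly increasing in the radius. -/
theorem strictMonoOn_radial (h : IsIncreasingTo f γ l) {a : ℝ} {p : ℝ → Plane}
    (hp : ∀ R, a ≤ R → γ ∩ Metric.sphere 0 R = {p R}) :
    StrictMonoOn (fun R => value f (p R)) (Ici a) := by
  obtain ⟨-, c, ⟨hcont, hinj, hc, hlim⟩, hmono, -⟩ := h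
  have hmem : ∀ R, a ≤ R → ∃ s ∈ Ioi (milnorRadius f), c s = p R ∧ ‖c s‖ = R := fun R hR => by
    have : p R ∈ γ ∩ Metric.sphere 0 R := by rw [hp R hR]; rfl
    obtain ⟨h1, h2⟩ := this
    rw [← hc] at h1
    obtain ⟨s, hs, hsp⟩ := h1
    exact ⟨s, hs, hsp, by simpa [hsp] using h2⟩
  intro R hR R' hR' hlt
  obtain ⟨s, hs, hsp, hsR⟩ := hmem R hR
  obtain ⟨s', hs', hsp', hsR'⟩ := hmem R' hR'
  dsimp only
  rw [← hsp, ← hsp']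
  refine hmono hs hs' ?_
  by_contra! hle
  -- otherwise the norm takes the value `R'` a second time, between `s` and infinity
  obtain ⟨u, hu, hsu⟩ := ((hlim.eventually_ge_atTop R').and (eventually_ge_atTop s)).exists
  have hsub : Icc s u ⊆ Ioi (milnorRadius f) := fun v hv => lt_of_lt_of_le hs hv.1
  obtain ⟨v, hv, hvR⟩ := intermediate_value_Icc hsu (hcont.mono hsub).norm
    (show R' ∈ Icc _ _ from ⟨by rw [hsR]; exact hlt.le, hu⟩)
  have hcv : c v ∈ γ ∩ Metric.sphere 0 R' := ⟨hc ▸ mem_image_of_mem c (hsub hv), by simpa using hvR⟩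
  rw [hp R' hR'] at hcv
  have hvs : v = s' := hinj (hsub hv) hs' (hcv.trans hsp'.symm)
  have hss : s' = s := le_antisymm hle (hvs ▸ hv.1)
  rw [← hsR, ← hsR', hss] at hlt
  exact lt_irrefl _ hlt

/-- An arc increasing to `l` that meets large circles once meets the levels slightly below `l` at
large radii. -/
theorem eventually_exists_radial (h : IsIncreasingTo f γ l) {a : ℝ} (ha : milnorRadius f < a)
    {p : ℝ → Plane} (hp : ∀ R, a ≤ R → γ ∩ Metric.sphere 0 R = {p R}) :
    ∀ᶠ t in 𝓝[<] l, ∃ R, a ≤ R ∧ value f (p R) = t := by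
  obtain ⟨-, c, ⟨-, -, hc, hlim⟩, -, hl⟩ := id h
  have hmono := h.strictMonoOn_radial hp
  have hcs : ∀ᶠ s in atTop, a ≤ ‖c s‖ ∧ c s = p ‖c s‖ := by
    filter_upwards [eventually_gt_atTop (milnorRadius f), hlim.eventually_ge_atTop a] with s hs hsa
    have : c s ∈ γ ∩ Metric.sphere 0 ‖c s‖ := ⟨hc ▸ mem_image_of_mem c hs, by simp⟩
    rw [hp _ hsa] at this
    exact ⟨hsa, this⟩
  have hlt : value f (p a) < l := by
    have h1 : value f (p a) < value f (p (a + 1)) :=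
      hmono (mem_Ici.2 le_rfl) (mem_Ici.2 (by linarith)) (by linarith)
    refine h1.trans_le (ge_of_tendsto hl ?_)
    filter_upwards [hcs, hlim.eventually_ge_atTop (a + 1)] with s hs hsa
    rw [hs.2]
    exact hmono.monotoneOn (mem_Ici.2 (by linarith)) hs.1 hsa
  filter_upwards [Ioo_mem_nhdsLT hlt] with t ht
  obtain ⟨s, hst, hsa, hsp⟩ := ((hl.eventually (eventually_gt_nhds ht.2)).and hcs).exists
  rw [hsp] at hst
  obtain ⟨R, hR, hRt⟩ := intermediate_value_Icc hsa
    ((continuous_value f).comp_continuousOn (h.1.continuousOn_radial ha hp ‖c s‖)) ⟨ht.1.le, hst.le⟩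
  exact ⟨R, hR.1, hRt⟩

end IsIncreasingTo

/-- Only finitely many Milnor arcs increase to `l`: they are disjoint, each meets every large
circle, and `M(f)` has a bounded number of points on arbitrarily large circles. -/
theorem finite_setOf_isIncreasingTo {f : Poly} (hf : IsPrimitive f) (l : ℝ) :
    {γ | IsIncreasingTo f γ l}.Finite := by
  classical
  obtain ⟨N, hN⟩ := exists_frequently_card_zeros_le hf.jac_rho_ne_zero
  by_contra hinf
  obtain ⟨A, hA, hcard⟩ := Set.Infinite.exists_subset_card_eq hinf (N + 1)
  have hev : ∀ᶠ R in atTop, ∀ γ ∈ A, ∃ x ∈ γ, ‖x‖ = R :=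
    (Filter.eventually_all_finset A).2 fun γ hγ => (hA hγ).eventually_exists_norm_eq
  obtain ⟨R, hR, hx⟩ := (hN.and_eventually hev).exists
  choose! x hxγ hxR using hx
  have hinj : Set.InjOn x A := fun γ hγ δ hδ he =>
    (hA hγ).1.eq_of_mem (hA hδ).1 (hxγ γ hγ) (he ▸ hxγ δ hδ)
  have := hR (A.image x) fun p hp => by
    obtain ⟨γ, hγ, rfl⟩ := Finset.mem_image.1 hp
    exact ⟨hxR γ hγ, ((hA hγ).1.subset (hxγ γ hγ)).1⟩
  rw [Finset.card_image_of_injOn hinj] at this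
  omega

/-! ### Levels between consecutive arcs -/

/-- Where a circular arc avoids `M(f)`, the angular derivative of `f` does not vanish, so `f` is
injective on it by Rolle's theorem. -/
theorem injOn_value_rot {f : Poly} {p : Plane} {θ : ℝ}
    (h : ∀ s ∈ Ioo 0 θ, rot s p ∉ milnorSet f) :
    InjOn (fun s => value f (rot s p)) (Icc 0 θ) := by
  have key : ∀ u ∈ Icc 0 θ, ∀ v ∈ Icc 0 θ, u < v →
      value f (rot u p) ≠ value f (rot v p) := by
    intro u hu v hv huv heq
    obtain ⟨s, hs, hs0⟩ := exists_hasDerivAt_eq_zero huv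
      (fun s _ => (hasDerivAt_value_rot f p s).continuousAt.continuousWithinAt) heq
      fun s _ => hasDerivAt_value_rot f p s
    refine h s ⟨hu.1.trans_lt hs.1, hs.2.trans_le hv.2⟩ ?_
    change value (jac f rho) (rot s p) = 0
    linarith
  intro u hu v hv heq
  rcases lt_trichotomy u v with h | h | h
  · exact absurd heq (key u hu v hv h)
  · exact h
  · exact absurd heq.symm (key v hv u hu h)

/-- The angle from a continuous family of nonzero vectors to another one depends continuously on
the parameter, as long as the two vectors never coincide. -/
theorem continuousOn_angle {p q : ℝ → Plane} {θ : ℝ → ℝ} {a b : ℝ}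
    (hp : ContinuousOn p (Icc a b)) (hq : ContinuousOn q (Icc a b))
    (hp0 : ∀ r ∈ Icc a b, p r ≠ 0) (hpq : ∀ r ∈ Icc a b, p r ≠ q r)
    (hθ : ∀ r ∈ Icc a b, θ r ∈ Icc 0 (2 * Real.pi) ∧ q r = rot (θ r) (p r)) :
    ContinuousOn θ (Icc a b) := by
  set K : Set (ℝ × ℝ) := (Icc a b ×ˢ Icc 0 (2 * Real.pi)) ∩
    (fun z => q z.1 - rot z.2 (p z.1)) ⁻¹' {0}
  have hmaps : MapsTo Prod.fst (Icc a b ×ˢ Icc 0 (2 * Real.pi)) (Icc a b) := fun z hz => hz.1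
  have hK : IsCompact K := by
    refine (isCompact_Icc.prod isCompact_Icc).of_isClosed_subset ?_ inter_subset_left
    refine ContinuousOn.preimage_isClosed_of_isClosed ?_ (isClosed_Icc.prod isClosed_Icc)
      isClosed_singleton
    have hq' : ContinuousOn (fun z : ℝ × ℝ => q z.1) (Icc a b ×ˢ Icc 0 (2 * Real.pi)) :=
      hq.comp continuous_fst.continuousOn hmaps
    have hp' : ContinuousOn (fun z : ℝ × ℝ => p z.1) (Icc a b ×ˢ Icc 0 (2 * Real.pi)) :=
      hp.comp continuous_fst.continuousOn hmaps
    have hrot : ContinuousOn (fun z : ℝ × ℝ => rot z.2 (p z.1))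
        (Icc a b ×ˢ Icc 0 (2 * Real.pi)) :=
      continuous_rot.comp_continuousOn (f := fun z : ℝ × ℝ => (z.2, p z.1))
        (continuous_snd.continuousOn.prodMk hp')
    exact hq'.sub hrot
  have hIoo : ∀ r α, (r, α) ∈ K → α ∈ Ioo 0 (2 * Real.pi) := by
    rintro r α ⟨⟨hr, hα⟩, h⟩
    have hqr : q r = rot α (p r) := sub_eq_zero.1 h
    refine ⟨lt_of_le_of_ne hα.1 ?_, lt_of_le_of_ne hα.2 ?_⟩
    · rintro rfl
      exact hpq r hr (by rw [hqr, rot_zero])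
    · rintro rfl
      exact hpq r hr (by rw [hqr, rot_two_pi])
  have hsec : ContinuousOn (fun r => (r, θ r)) (Icc a b) := by
    refine continuousOn_section_of_isCompact hK continuous_fst.continuousOn ?_ fun r hr =>
      ⟨⟨⟨hr, (hθ r hr).1⟩, sub_eq_zero.2 (hθ r hr).2⟩, rfl⟩
    rintro ⟨r, α⟩ hα ⟨r', β⟩ hβ (rfl : r = r')
    refine Prod.ext rfl (eq_of_rot_eq_rot (hp0 r hα.1.1) (hIoo r α hα) (hIoo r β hβ) ?_)
    exact (sub_eq_zero.1 hα.2).symm.trans (sub_eq_zero.1 hβ.2)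
  exact continuous_snd.comp_continuousOn hsec

/-- In the sector between two consecutive arcs `γ`, `δ` increasing to `l`, a level `t` close to `l`
is attained on the circles whose radius lies between the radii at which `γ` and `δ` reach `t`: on
these `f` is at least `t` on one arc and at most `t` on the other. There the level is a graph over
the radius, joining the points of `γ` and of `δ`. -/
theorem IsConsecutiveArc.eventually_connectedComponentIn_eq {f : Poly} {γ δ : Set Plane} {l : ℝ}
    (h : IsConsecutiveArc f γ δ) (hγ : IsIncreasingTo f γ l) (hδ : IsIncreasingTo f δ l) :
    ∀ᶠ t in 𝓝[<] l, ∀ x ∈ γ, ∀ y ∈ δ, value f x = t → value f y = t →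
      connectedComponentIn {z | value f z = t} x = connectedComponentIn {z | value f z = t} y := by
  by_cases hne : γ = δ
  · subst hne
    refine Eventually.of_forall fun t x hx y hy hxt hyt => ?_
    rw [hγ.eq_of_value_eq hx hy (hxt.trans hyt.symm)]
  obtain ⟨a, ha⟩ := eventually_atTop.1 (h.2.2.and (eventually_gt_atTop (milnorRadius f)))
  have haR : milnorRadius f < a := (ha a le_rfl).2
  have ha0 : 0 < a := (milnorRadius_nonneg f).trans_lt haR
  have hsec : ∀ R, ∃ p q : Plane, ∃ θ : ℝ, a ≤ R → γ ∩ Metric.sphere 0 R = {p} ∧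
      δ ∩ Metric.sphere 0 R = {q} ∧ 0 < θ ∧ θ ≤ 2 * Real.pi ∧ q = rot θ p ∧
        ∀ s ∈ Ioo 0 θ, rot s p ∉ milnorSet f := by
    intro R
    by_cases hR : a ≤ R
    · obtain ⟨p, q, hp, hq, θ, hθ⟩ := (ha R hR).1
      exact ⟨p, q, θ, fun _ => ⟨hp, hq, hθ⟩⟩
    · exact ⟨0, 0, 0, fun h => absurd h hR⟩
  choose p q θ hsec using hsec
  have hp : ∀ R, a ≤ R → γ ∩ Metric.sphere 0 R = {p R} := fun R hR => (hsec R hR).1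
  have hq : ∀ R, a ≤ R → δ ∩ Metric.sphere 0 R = {q R} := fun R hR => (hsec R hR).2.1
  have hpm : ∀ R, a ≤ R → p R ∈ γ ∩ Metric.sphere 0 R := fun R hR => by rw [hp R hR]; rfl
  have hqm : ∀ R, a ≤ R → q R ∈ δ ∩ Metric.sphere 0 R := fun R hR => by rw [hq R hR]; rfl
  have hpcont := hγ.1.continuousOn_radial haR hp
  have hqcont := hδ.1.continuousOn_radial haR hq
  have hθcont : ∀ b, ContinuousOn θ (Icc a b) := fun b => by
    refine continuousOn_angle (hpcont b) (hqcont b) (fun r hr h0 => ?_) (fun r hr heq => ?_)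
      fun r hr => ⟨⟨(hsec r hr.1).2.2.1.le, (hsec r hr.1).2.2.2.1⟩, (hsec r hr.1).2.2.2.2.1⟩
    · have := (hpm r hr.1).2
      rw [h0, mem_sphere_zero_iff_norm, norm_zero] at this
      linarith [hr.1]
    · exact hne (hγ.1.eq_of_mem hδ.1 (hpm r hr.1).1 (heq ▸ (hqm r hr.1).1))
  set G : ℝ × ℝ → Plane := fun z => rot (z.2 * θ z.1) (p z.1)
  have hG0 : ∀ r, G (r, 0) = p r := fun r => by simp [G]
  have hG1 : ∀ r, a ≤ r → G (r, 1) = q r := fun r hr => by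
    simpa [G] using (hsec r hr).2.2.2.2.1.symm
  have hG : ∀ r r', a ≤ r → ContinuousOn G (Icc r r' ×ˢ Icc 0 1) := fun r r' hr => by
    have hmaps : MapsTo Prod.fst (Icc r r' ×ˢ Icc (0 : ℝ) 1) (Icc a r') :=
      fun z hz => ⟨hr.trans hz.1.1, hz.1.2⟩
    have hp' : ContinuousOn (fun z : ℝ × ℝ => p z.1) (Icc r r' ×ˢ Icc 0 1) :=
      (hpcont r').comp continuous_fst.continuousOn hmaps
    have hθ' : ContinuousOn (fun z : ℝ × ℝ => θ z.1) (Icc r r' ×ˢ Icc 0 1) :=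
      (hθcont r').comp continuous_fst.continuousOn hmaps
    exact continuous_rot.comp_continuousOn (f := fun z : ℝ × ℝ => (z.2 * θ z.1, p z.1))
      ((continuous_snd.continuousOn.mul hθ').prodMk hp')
  have hinj : ∀ r, a ≤ r → InjOn (fun u => value f (G (r, u))) (Icc 0 1) := by
    intro r hr u hu v hv huv
    have hpos := (hsec r hr).2.2.1
    have hmem : ∀ w ∈ Icc (0 : ℝ) 1, w * θ r ∈ Icc 0 (θ r) := fun w hw =>
      ⟨mul_nonneg hw.1 hpos.le, mul_le_of_le_one_left hpos.le hw.2⟩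
    exact mul_right_cancel₀ hpos.ne'
      (injOn_value_rot (hsec r hr).2.2.2.2.2 (hmem u hu) (hmem v hv) huv)
  have hpmono := (hγ.strictMonoOn_radial hp).monotoneOn
  have hqmono := (hδ.strictMonoOn_radial hq).monotoneOn
  filter_upwards [hγ.eventually_exists_radial haR hp, hδ.eventually_exists_radial haR hq]
    with t ⟨r, hr, hrt⟩ ⟨r', hr', hrt'⟩ x hx y hy hxt hyt
  rw [hγ.eq_of_value_eq hx (hpm r hr).1 (hxt.trans hrt.symm),
    hδ.eq_of_value_eq hy (hqm r' hr').1 (hyt.trans hrt'.symm), ← hG0 r, ← hG1 r' hr']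
  rcases le_total r r' with hle | hle
  · refine connectedComponentIn_eq_of_band hle (continuous_value f) (hG r r' hr)
      (fun s hs => hinj s (hr.trans hs.1)) (fun s hs => ?_) (by simp) (by simp)
      (by rw [hG0, hrt]) (by rw [hG1 r' hr', hrt'])
    have hs' := hr.trans hs.1
    rw [hG0, hG1 s hs']
    exact mem_uIcc.2 (Or.inr ⟨hrt' ▸ hqmono hs' hr' hs.2, hrt ▸ hpmono hr hs' hs.1⟩)
  · refine (connectedComponentIn_eq_of_band hle (continuous_value f) (hG r' r hr')
      (fun s hs => hinj s (hr'.trans hs.1)) (fun s hs => ?_) (by simp) (by simp)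
      (by rw [hG1 r' hr', hrt']) (by rw [hG0, hrt])).symm
    have hs' := hr'.trans hs.1
    rw [hG0, hG1 s hs']
    exact mem_uIcc.2 (Or.inl ⟨hrt ▸ hpmono hs' hr hs.2, hrt' ▸ hqmono hr' hs' hs.1⟩)

end MilnorCluster

theorem mainTheorem10 (f : MilnorCluster.Poly) (hf : MilnorCluster.IsPrimitive f)
    (l : ℝ) (hl : MilnorCluster.IsRegularValue f l) :
    ∃ η : ℝ, 0 < η ∧ ∀ t ∈ Set.Ioo (l - η) l,
      ∀ (n : ℕ) (C : Fin (n + 1) → Set MilnorCluster.Plane),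
        MilnorCluster.IsIncreasingCluster f l C →
          ∃! K : Set MilnorCluster.Plane,
            MilnorCluster.IsComponentOf K {p | MilnorCluster.value f p = t} ∧
              ∀ i, (K ∩ C i).Nonempty := by
  open MilnorCluster in
  have hfin := finite_setOf_isIncreasingTo hf l
  have hpoint : ∀ᶠ t in 𝓝[<] l, ∀ γ ∈ {γ | IsIncreasingTo f γ l}, ∃ x ∈ γ, value f x = t :=
    (eventually_all_finite hfin).2 fun γ hγ => hγ.eventually_exists_value_eq
  have hpair : ∀ᶠ t in 𝓝[<] l, ∀ γ ∈ {γ | IsIncreasingTo f γ l}, ∀ δ ∈ {δ | IsIncreasingTo f δ l},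
      IsConsecutiveArc f γ δ → ∀ x ∈ γ, ∀ y ∈ δ, value f x = t → value f y = t →
        connectedComponentIn {z | value f z = t} x =
          connectedComponentIn {z | value f z = t} y := by
    refine (eventually_all_finite hfin).2 fun γ hγ => (eventually_all_finite hfin).2 fun δ hδ => ?_
    by_cases h : IsConsecutiveArc f γ δ
    · filter_upwards [h.eventually_connectedComponentIn_eq hγ hδ] with t ht _ using ht
    · exact Eventually.of_forall fun t h' => absurd h' h
  obtain ⟨l', hl', hsub⟩ := (mem_nhdsLT_iff_exists_Ioo_subset' (sub_one_lt l)).1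
    (hpoint.and hpair)
  refine ⟨l - l', sub_pos.2 hl', fun t ht n C hC => ?_⟩
  rw [sub_sub_cancel] at ht
  obtain ⟨hpoint, hpair⟩ := hsub ht
  choose x hxC hxt using fun i => hpoint (C i) (hC.increasing i)
  have hcomp : ∀ i, connectedComponentIn {z | value f z = t} (x 0) =
      connectedComponentIn {z | value f z = t} (x i) := by
    intro i
    induction i using Fin.induction with
    | zero => rfl
    | succ i ih =>
      exact ih.trans (hpair _ (hC.increasing _) _ (hC.increasing _) (hC.consecutive i) _ (hxC _)
        _ (hxC _) (hxt _) (hxt _))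
  refine ⟨connectedComponentIn {z | value f z = t} (x 0), ⟨⟨x 0, hxt 0, rfl⟩, fun i => ?_⟩, ?_⟩
  · rw [hcomp i]
    exact ⟨x i, mem_connectedComponentIn (hxt i), hxC i⟩
  · -- a component that meets the first arc does so at the only point of that arc at level `t`
    rintro _ ⟨⟨p, -, rfl⟩, hK⟩
    obtain ⟨z, hzK, hz⟩ := hK 0
    have hzt : value f z = t :=
      connectedComponentIn_subset {p | value f p = t} p hzK
    rw [connectedComponentIn_eq hzK,
      (hC.increasing 0).eq_of_value_eq hz (hxC 0) (hzt.trans (hxt 0).symm)]
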